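/- **Theorem 1.3.** Let $G$ be the real Heisenberg group of the matrices $\begin{pmatrix}1&a&c\\0&1&b\\0&0&1\end{pmatrix}$ with $a,b,c\in\mathbb R$, let $\Gamma\subset G$ be the subgroup of the matrices with integer entries, let $\mathbb T=\mathbb R/\mathbb Z$, and let $X=\mathbb T\times\Gamma\backslash G$, where $\Gamma\backslash G$ is the space of cosets $\Gamma g$ with the quotient topology. Let $\varphi,\eta,\psi:\mathbb R\to\mathbb R$ be $C^\infty$ functions of period $1$ with $\int_0^1\varphi(t)\,dt=\int_0^1\eta(t)\,dt=0$, let $\alpha$ be an irrational real number, and let $$S_\alpha:X\to X,\qquad S_\alpha(t,\Gamma g)=\left(t+\alpha,\ \Gamma g\begin{pmatrix}1&\varphi(t)&\psi(t)\\0&1&\eta(t)\\0&0&1\end{pmatrix}\right).$$ For a distance function $d:X\times X\to[0,\infty)$, a Borel probability measure $\rho$ on $X$, $n\ge 1$ and $\varepsilon>0$, put $$\bar d_n(x,y)=\frac1n\sum_{j=0}^{n-1}d(S_\alpha^jx,S_\alpha^jy)$$ and let $s_n(d,\rho,\varepsilon)$ be the least $m\in\mathbb N$ such that $$\rho\Big(\bigcup_{j=1}^m\{y\in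 X:\bar d_n(x_j,y)<\varepsilon\}\Big)>1-\varepsilon\quad\text{for some }x_1,\dots,x_m\in X.$$ The measure complexity of $(X,S_\alpha,\rho)$ with respect to $d$ is called sub-polynomial if $$\liminf_{n\to\infty}\frac{s_n(d,\rho,\varepsilon)}{n^\tau}=0\qquad\text{for all }\tau>0\text{ and all }\varepsilon>0 .$$ Then, for every $S_\alpha$-invariant Borel probability measure $\rho$ on $X$, the measure complexity of $(X,S_\alpha,\rho)$ is sub-polynomial. This holds with respect to 1. the distance $d\big((t,\Gamma g),(t',\Gamma g')\big)=\sqrt{\|t-t'\|^2+\big(\inf_{\gamma\in\Gamma}d_G(g,\gamma g')\big)^2}$, where $\|\cdot\|$ is the distance to the nearest integer and $d_G$ is any left-invariant metric on $G$ such that $d_G(g,g')\le\max(|b|,|a|,|c-ab|)$ whenever $g^{-1}g'=\begin{pmatrix}1&a&c\\0&1&b\\0&0&1\end{pmatrix}$; 2. every metric $d$ that induces the topology of $X$. -/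

import Mathlib

open scoped ContDiff

noncomputable section

namespace HeisSkew

/-! ### The Heisenberg group -/

/-- The real Heisenberg group: `⟨a, b, c⟩` stands for the unipotent upper triangular matrix with
rows `(1, a, c)`, `(0, 1, b)`, `(0, 0, 1)`. -/
@[ext] structure Heis where
  a : ℝ
  b : ℝ
  c : ℝ

namespace Heis

/-- The matrix that an element of the Heisenberg group stands for. -/
def toMatrix (g : Heis) : Matrix (Fin 3) (Fin 3) ℝ :=
  !![1, g.a, g.c; 0, 1, g.b; 0, 0, 1]

instance : Mul Heis := ⟨fun g h => ⟨g.a + h.a, g.b + h.b, g.c + h.c + g.a * h.b⟩⟩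
instance : One Heis := ⟨⟨0, 0, 0⟩⟩
instance : Inv Heis := ⟨fun g => ⟨-g.a, -g.b, g.a * g.b - g.c⟩⟩

@[simp] theorem mul_a (g h : Heis) : (g * h).a = g.a + h.a := rfl
@[simp] theorem mul_b (g h : Heis) : (g * h).b = g.b + h.b := rfl
@[simp] theorem mul_c (g h : Heis) : (g * h).c = g.c + h.c + g.a * h.b := rfl
@[simp] theorem one_a : (1 : Heis).a = 0 := rfl
@[simp] theorem one_b : (1 : Heis).b = 0 := rfl
@[simp] theorem one_c : (1 : Heis).c = 0 := rfl
@[simp] theorem inv_a (g : Heis) : (g⁻¹).a = -g.a := rfl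
@[simp] theorem inv_b (g : Heis) : (g⁻¹).b = -g.b := rfl
@[simp] theorem inv_c (g : Heis) : (g⁻¹).c = g.a * g.b - g.c := rfl

instance : Group Heis :=
  Group.ofLeftAxioms
    (fun x y z => by ext <;> simp <;> ring)
    (fun x => by ext <;> simp)
    (fun x => by ext <;> simp)

/-- The multiplication is matrix multiplication. -/
theorem toMatrix_mul (g h : Heis) : (g * h).toMatrix = g.toMatrix * h.toMatrix := by
  ext i j
  fin_cases i <;> fin_cases j <;>
    simp [toMatrix, Matrix.mul_apply, Fin.sum_univ_three] <;> ring

theorem toMatrix_one : (1 : Heis).toMatrix = 1 := by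
  ext i j
  fin_cases i <;> fin_cases j <;> simp [toMatrix]

/-- The topology of `ℝ³` in the matrix entries. -/
instance : TopologicalSpace Heis :=
  TopologicalSpace.induced (fun g : Heis => (g.a, g.b, g.c)) inferInstance

end Heis

/-- The lattice of the elements with integer entries. -/
def Gam : Subgroup Heis where
  carrier := {g | (∃ k : ℤ, g.a = k) ∧ (∃ k : ℤ, g.b = k) ∧ ∃ k : ℤ, g.c = k}
  one_mem' := ⟨⟨0, by simp⟩, ⟨0, by simp⟩, ⟨0, by simp⟩⟩
  mul_mem' := by
    rintro g h ⟨⟨p, hp⟩, ⟨q, hq⟩, ⟨r, hr⟩⟩ ⟨⟨p', hp'⟩, ⟨q', hq'⟩, ⟨r', hr'⟩⟩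
    exact ⟨⟨p + p', by simp [hp, hp']⟩, ⟨q + q', by simp [hq, hq']⟩,
      ⟨r + r' + p * q', by simp [hr, hr', hp, hq']⟩⟩
  inv_mem' := by
    rintro g ⟨⟨p, hp⟩, ⟨q, hq⟩, ⟨r, hr⟩⟩
    exact ⟨⟨-p, by simp [hp]⟩, ⟨-q, by simp [hq]⟩, ⟨p * q - r, by simp [hp, hq, hr]⟩⟩

/-- The Heisenberg nilmanifold: the space of the cosets `Γ g`. -/
def Nil : Type := Quotient (QuotientGroup.rightRel Gam)

namespace Nil

/-- The coset `Γ g`. -/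
def mk (g : Heis) : Nil := Quotient.mk (QuotientGroup.rightRel Gam) g

/-- The quotient topology. -/
instance : TopologicalSpace Nil :=
  inferInstanceAs (TopologicalSpace (Quotient (QuotientGroup.rightRel Gam)))

theorem mk_eq_mk_iff (g h : Heis) : mk g = mk h ↔ h * g⁻¹ ∈ Gam :=
  Quotient.eq.trans QuotientGroup.rightRel_apply

/-- The right translation `Γ g ↦ Γ g h`. -/
def rmul (x : Nil) (h : Heis) : Nil :=
  Quotient.liftOn x (fun g => mk (g * h)) (by
    intro g g' hg
    refine (mk_eq_mk_iff _ _).2 ?_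
    have h1 : g' * g⁻¹ ∈ Gam := QuotientGroup.rightRel_apply.1 hg
    simpa [mul_assoc] using h1)

theorem rmul_mk (g h : Heis) : rmul (mk g) h = mk (g * h) := rfl

/-- The distance of two cosets that a distance `δ` on the group induces: the infimum of
the distances of their elements. -/
def ndist (δ : Heis → Heis → ℝ) (x y : Nil) : ℝ :=
  sInf {r : ℝ | ∃ g h : Heis, mk g = x ∧ mk h = y ∧ r = δ g h}

/-- For a left invariant `δ` one may fix one of the representatives. -/
theorem ndist_mk (δ : Heis → Heis → ℝ) (hδ : ∀ k g h : Heis, δ (k * g) (k * h) = δ g h)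
    (g h : Heis) : ndist δ (mk g) (mk h) = ⨅ γ : Gam, δ g (γ * h) := by
  unfold ndist iInf
  congr 1
  ext r
  constructor
  · rintro ⟨g', h', hg, hh, rfl⟩
    have h1 := (mk_eq_mk_iff _ _).1 hg
    have h2 := (mk_eq_mk_iff _ _).1 hh.symm
    refine ⟨⟨g * g'⁻¹ * (h' * h⁻¹), Gam.mul_mem h1 h2⟩, ?_⟩
    have h3 := hδ (g * g'⁻¹) g' h'
    simpa [mul_assoc] using h3
  · rintro ⟨γ, rfl⟩
    refine ⟨g, γ * h, rfl, ?_, rfl⟩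
    rw [mk_eq_mk_iff]
    simp

end Nil

/-! ### The phase space and the skew product -/

/-- The product of the circle `ℝ/ℤ` and the Heisenberg nilmanifold, with the product topology and
its Borel sets. -/
def Phase : Type := UnitAddCircle × Nil

instance : TopologicalSpace Phase := inferInstanceAs (TopologicalSpace (UnitAddCircle × Nil))
instance : MeasurableSpace Phase := borel Phase
instance : BorelSpace Phase := ⟨rfl⟩

/-- The skew product `(t, Γ g) ↦ (t + α, Γ g M(t))`, where `M(t)` is the matrix with rows
`(1, φ(t), ψ(t))`, `(0, 1, η(t))`, `(0, 0, 1)`. -/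
def skew (α : ℝ) {φ η ψ : ℝ → ℝ} (hφ : Function.Periodic φ 1) (hη : Function.Periodic η 1)
    (hψ : Function.Periodic ψ 1) (p : Phase) : Phase :=
  (p.1 + (α : UnitAddCircle), p.2.rmul ⟨hφ.lift p.1, hη.lift p.1, hψ.lift p.1⟩)

theorem skew_mk (α : ℝ) {φ η ψ : ℝ → ℝ} (hφ : Function.Periodic φ 1)
    (hη : Function.Periodic η 1) (hψ : Function.Periodic ψ 1) (t : ℝ) (g : Heis) :
    skew α hφ hη hψ ((t : UnitAddCircle), Nil.mk g) =
      (((t + α : ℝ) : UnitAddCircle), Nil.mk (g * ⟨φ t, η t, ψ t⟩)) := rfl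

/-- The distance `√(‖t - t'‖² + d(Γ g, Γ g')²)` on the phase space that a distance on the
Heisenberg group induces; `‖t - t'‖` is the distance of `t - t'` to the nearest integer. -/
def pdist (δ : Heis → Heis → ℝ) (p q : Phase) : ℝ :=
  Real.sqrt (‖p.1 - q.1‖ ^ 2 + Nil.ndist δ p.2 q.2 ^ 2)

/-- The maximum of the absolute values of the coordinates `b`, `a`, `c - a b` of an element of the
Heisenberg group. -/
def kap (g : Heis) : ℝ := max |g.b| (max |g.a| |g.c - g.a * g.b|)

/-! ### Measure complexity -/

section Complexity

variable {X : Type*}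

/-- The mean distance along the first `n` points of two orbits. -/
def meanDist (T : X → X) (d : X → X → ℝ) (n : ℕ) (x y : X) : ℝ :=
  (1 / (n : ℝ)) * ∑ j ∈ Finset.range n, d (T^[j] x) (T^[j] y)

/-- The least number of open `ε`-balls for the mean distance whose union has measure greater than
`1 - ε` (and `⊤` if no finite number of balls suffices). -/
def coverNum [MeasurableSpace X] (T : X → X) (d : X → X → ℝ) (ν : MeasureTheory.Measure X) (n : ℕ)
    (ε : ℝ) : ℕ∞ :=
  sInf {k : ℕ∞ | ∃ (m : ℕ) (x : Fin m → X), k = m ∧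
    1 - ε < ν.real (⋃ j, {y | meanDist T d n (x j) y < ε})}

/-- Sub-polynomial measure complexity with respect to the distance `d`. -/
def SubPolynomial [MeasurableSpace X] (T : X → X) (d : X → X → ℝ)
    (ν : MeasureTheory.Measure X) : Prop :=
  ∀ τ : ℝ, 0 < τ → ∀ ε : ℝ, 0 < ε →
    Filter.liminf (fun n : ℕ => ((coverNum T d ν n ε : ℕ∞) : ENNReal) / (n : ENNReal) ^ τ)
      Filter.atTop = 0

/-- The metric induces the given topology. -/
def Induces [t : TopologicalSpace X] (m : MetricSpace X) : Prop :=
  m.toPseudoMetricSpace.toUniformSpace.toTopologicalSpace = t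

end Complexity

end HeisSkew

end

/-!
Let `q` be the denominator of a rational number within `1 / q ^ 2` of `α`. Then `‖m α‖` is at least
of order `1 / q` for `0 < |m| ≤ q / 2`, so the coboundary equation over the rotation by `α` can be
solved for trigonometric polynomials of degree at most `q / 2` with the loss of a factor `q`. A
smooth function agrees with a trigonometric polynomial of degree `q / 4` up to any power of `1 / q`.
Since `φ` and `η` have mean zero, solving the equations for the entries `φ`, `η` and then for the
corner entry gives a change of coordinates `W`, of size and Lipschitz constant at most `q ^ 7`, that
turns the generator of the skew product into a central constant up to an error `1 / q ^ B`, for any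
`B`. The central constant cancels in the difference of two orbits, so in the new coordinates nearby
orbits stay together for `q ^ b` steps. Hence a number of orbits that is a fixed power of `q`
shadows all orbits of length `q ^ b`, and letting `b → ∞` beats every exponent `τ`.
-/

noncomputable section

open Filter MeasureTheory Set Topology

namespace HeisSkew

/-! ### Small divisors -/

theorem exists_coe_eq_and_abs_eq_norm (x : UnitAddCircle) :
    ∃ t : ℝ, (t : UnitAddCircle) = x ∧ |t| = ‖x‖ := by
  induction x using QuotientAddGroup.induction_on with
  | H t =>
    refine ⟨t - round t, ?_, UnitAddCircle.norm_eq.symm⟩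
    simp

theorem norm_toCircle_sub_one (t : ℝ) :
    ‖(AddCircle.toCircle (t : UnitAddCircle) : ℂ) - 1‖ = 2 * |Real.sin (Real.pi * t)| := by
  rw [AddCircle.toCircle_apply_mk, Circle.coe_exp, mul_comm _ Complex.I,
    Complex.norm_exp_I_mul_ofReal_sub_one, norm_mul, Real.norm_two, Real.norm_eq_abs]
  congr 3
  ring

theorem four_mul_norm_le_norm_toCircle_sub_one (x : UnitAddCircle) :
    4 * ‖x‖ ≤ ‖(AddCircle.toCircle x : ℂ) - 1‖ := by
  obtain ⟨t, rfl, ht⟩ := exists_coe_eq_and_abs_eq_norm x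
  have hpi := Real.pi_pos
  have hhalf : |t| ≤ 1 / 2 := by
    simpa [ht] using AddCircle.norm_le_half_period (1 : ℝ) (x := t) one_ne_zero
  have hsin : 2 / Real.pi * |Real.pi * t| ≤ |Real.sin (Real.pi * t)| := by
    refine Real.mul_abs_le_abs_sin ?_
    rw [abs_mul, abs_of_pos hpi]
    nlinarith
  rw [abs_mul, abs_of_pos hpi, ← mul_assoc, div_mul_cancel₀ _ hpi.ne', ht] at hsin
  rw [norm_toCircle_sub_one]
  linarith

theorem norm_toCircle_sub_one_le (x : UnitAddCircle) :
    ‖(AddCircle.toCircle x : ℂ) - 1‖ ≤ 2 * Real.pi * ‖x‖ := by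
  obtain ⟨t, rfl, ht⟩ := exists_coe_eq_and_abs_eq_norm x
  rw [norm_toCircle_sub_one, ← ht, mul_assoc]
  gcongr
  simpa [abs_mul, abs_of_pos Real.pi_pos] using Real.abs_sin_le_abs (x := Real.pi * t)

theorem norm_fourier_sub_le (m : ℤ) (x y : UnitAddCircle) :
    ‖fourier m x - fourier m y‖ ≤ 2 * Real.pi * |m| * ‖x - y‖ := by
  have hfactor : fourier m x - fourier m y
      = fourier m y * ((AddCircle.toCircle (m • (x - y)) : ℂ) - 1) := by
    simp only [fourier_apply, mul_sub, mul_one, ← Circle.coe_mul, ← AddCircle.toCircle_add,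
      smul_sub, add_sub_cancel]
  rw [hfactor, norm_mul, fourier_apply, Circle.norm_coe, one_mul, mul_assoc _ (_ : ℝ)]
  refine (norm_toCircle_sub_one_le _).trans ?_
  gcongr
  simpa [Int.norm_eq_abs] using norm_zsmul_le m (x - y)

/-- Small divisor condition: at `θ` the characters of frequency `0 < |m| ≤ q / 2` keep the distance
`1 / q` from `1`, so that the coboundary equation over the rotation by `θ` can be solved for
trigonometric polynomials of degree at most `q / 2` with the loss of a factor `q`. -/
def HasSmallDivisorBound (θ : UnitAddCircle) (q : ℕ) : Prop :=
  ∀ m : ℤ, m ≠ 0 → 2 * |m| ≤ q → 1 / (q : ℝ) ≤ ‖fourier m θ - 1‖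

theorem one_div_den_le_norm_zsmul (r : ℚ) {m : ℤ} (hm : m ≠ 0) (hmr : |m| < r.den) :
    1 / (r.den : ℝ) ≤ ‖m • ((r : ℝ) : UnitAddCircle)‖ := by
  have horder : addOrderOf ((r : ℝ) : UnitAddCircle) = r.den := by
    simpa using AddCircle.addOrderOf_coe_rat (p := (1 : ℝ)) (q := r)
  set x : UnitAddCircle := m • ((r : ℝ) : UnitAddCircle)
  have hdvd : addOrderOf x ∣ r.den :=
    horder ▸ addOrderOf_dvd_of_mem_zmultiples (AddSubgroup.zsmul_mem_zmultiples _ m)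
  have hfin : IsOfFinAddOrder x := addOrderOf_pos_iff.1 (Nat.pos_of_dvd_of_pos hdvd r.pos)
  have hne : x ≠ 0 := fun h => hm <| Int.eq_zero_of_abs_lt_dvd
    (horder ▸ addOrderOf_dvd_iff_zsmul_eq_zero.2 h) hmr
  have h1 : 1 ≤ addOrderOf x • ‖x‖ := AddCircle.le_add_order_smul_norm_of_isOfFinAddOrder hfin hne
  rw [nsmul_eq_mul] at h1
  rw [div_le_iff₀' (by exact_mod_cast r.pos)]
  refine h1.trans ?_
  gcongr
  exact Nat.le_of_dvd r.pos hdvd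

theorem hasSmallDivisorBound_den {α : ℝ} {r : ℚ} (hr : |α - r| ≤ 1 / (r.den : ℝ) ^ 2) :
    HasSmallDivisorBound (α : UnitAddCircle) r.den := by
  intro m hm hmr
  have : (0 : ℝ) < r.den := by exact_mod_cast r.pos
  have hmq : |(m : ℝ)| ≤ r.den / 2 := by
    rw [le_div_iff₀' two_pos]
    exact_mod_cast hmr
  have herr : ‖m • ((α - r : ℝ) : UnitAddCircle)‖ ≤ 1 / (2 * r.den) :=
    calc ‖m • ((α - r : ℝ) : UnitAddCircle)‖ = ‖((m * (α - r) : ℝ) : UnitAddCircle)‖ := by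
          rw [← zsmul_eq_mul, AddCircle.coe_zsmul]
      _ ≤ |(m : ℝ)| * |α - r| := by
          rw [← abs_mul]
          exact QuotientAddGroup.norm_mk_le_norm
      _ ≤ r.den / 2 * (1 / (r.den : ℝ) ^ 2) := by gcongr
      _ = 1 / (2 * r.den) := by field_simp
  have hsum : 1 / (r.den : ℝ) ≤ ‖m • (α : UnitAddCircle)‖ + 1 / (2 * r.den) :=
    calc 1 / (r.den : ℝ) ≤ ‖m • ((r : ℝ) : UnitAddCircle)‖ :=
          one_div_den_le_norm_zsmul r hm (by have := r.pos; omega)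
      _ = ‖m • (α : UnitAddCircle) - m • ((α - r : ℝ) : UnitAddCircle)‖ := by
          rw [AddCircle.coe_sub, ← smul_sub, sub_sub_cancel]
      _ ≤ _ := (norm_sub_le _ _).trans (by gcongr)
  have hhalf : 1 / (2 * (r.den : ℝ)) = 1 / r.den / 2 := by field_simp
  have hpos : 0 < 1 / (r.den : ℝ) := by positivity
  rw [fourier_apply]
  linarith [four_mul_norm_le_norm_toCircle_sub_one (m • (α : UnitAddCircle))]

theorem frequently_exists_den_eq_and_abs_sub_le {α : ℝ} (hα : Irrational α) :
    ∃ᶠ q : ℕ in atTop, ∃ r : ℚ, r.den = q ∧ |α - r| ≤ 1 / (r.den : ℝ) ^ 2 := by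
  rw [frequently_atTop]
  intro Q
  obtain ⟨ε, hε, hε0 : 0 < ε⟩ := (((hα.eventually_forall_le_dist_cast_rat_of_den_le Q).filter_mono
    nhdsWithin_le_nhds).and (self_mem_nhdsWithin (s := Ioi 0))).exists
  obtain ⟨n, hn⟩ := exists_nat_one_div_lt hε0
  obtain ⟨r, hr, hrn⟩ := Real.exists_rat_abs_sub_le_and_den_le α n.succ_pos
  have hn0 : (0 : ℝ) < n + 1 := by positivity
  have hd1 : (1 : ℝ) ≤ r.den := by exact_mod_cast r.pos
  have hdn : (r.den : ℝ) ≤ n + 1 := by exact_mod_cast hrn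
  push_cast at hr
  refine ⟨r.den, ?_, r, rfl, hr.trans (one_div_le_one_div_of_le (by positivity) (by nlinarith))⟩
  by_contra! hlt
  have hclose : |α - r| ≤ 1 / (n + 1) :=
    hr.trans (one_div_le_one_div_of_le hn0 (by nlinarith))
  exact absurd ((hε r hlt.le).trans_eq (Real.dist_eq _ _)) (by linarith)

theorem frequently_hasSmallDivisorBound {α : ℝ} (hα : Irrational α) :
    ∃ᶠ q : ℕ in atTop, HasSmallDivisorBound (α : UnitAddCircle) q :=
  (frequently_exists_den_eq_and_abs_sub_le hα).mono fun _ ⟨_, hrq, hr⟩ =>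
    hrq ▸ hasSmallDivisorBound_den hr

/-! ### Trigonometric polynomials -/

theorem fourier_add_apply (m : ℤ) (x y : UnitAddCircle) :
    fourier m (x + y) = fourier m x * fourier m y := by
  simp only [fourier_apply, smul_add, AddCircle.toCircle_add, Circle.coe_mul]

/-- Trigonometric polynomials of degree at most `K` and Wiener norm (the sum of the absolute values
of the coefficients) at most `A`. The frequencies `ν i` need not be distinct, so that sums and
products require no collection of terms. -/
def IsTrigPoly (K : ℕ) (A : ℝ) (u : UnitAddCircle → ℂ) : Prop :=
  ∃ (ι : Type) (s : Finset ι) (ν : ι → ℤ) (a : ι → ℂ), (∀ i ∈ s, |ν i| ≤ K) ∧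
    ∑ i ∈ s, ‖a i‖ ≤ A ∧ ∀ x, u x = ∑ i ∈ s, a i * fourier (ν i) x

namespace IsTrigPoly

variable {K K' : ℕ} {A A' : ℝ} {u u' : UnitAddCircle → ℂ}

theorem mono (hu : IsTrigPoly K A u) (hK : K ≤ K') (hA : A ≤ A') : IsTrigPoly K' A' u := by
  obtain ⟨ι, s, ν, a, hν, ha, h⟩ := hu
  exact ⟨ι, s, ν, a, fun i hi => (hν i hi).trans (by exact_mod_cast hK), ha.trans hA, h⟩

theorem nonneg (hu : IsTrigPoly K A u) : 0 ≤ A := by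
  obtain ⟨ι, s, ν, a, -, ha, -⟩ := hu
  exact (Finset.sum_nonneg fun i _ => norm_nonneg (a i)).trans ha

theorem continuous (hu : IsTrigPoly K A u) : Continuous u := by
  obtain ⟨ι, s, ν, a, -, -, h⟩ := hu
  rw [funext h]
  fun_prop

theorem norm_le (hu : IsTrigPoly K A u) (x : UnitAddCircle) : ‖u x‖ ≤ A := by
  obtain ⟨ι, s, ν, a, -, ha, h⟩ := hu
  rw [h]
  refine (norm_sum_le_of_le s fun i _ => ?_).trans ha
  rw [norm_mul, fourier_apply, Circle.norm_coe, mul_one]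

theorem norm_sub_le (hu : IsTrigPoly K A u) (x y : UnitAddCircle) :
    ‖u x - u y‖ ≤ A * (2 * Real.pi * K * ‖x - y‖) := by
  obtain ⟨ι, s, ν, a, hν, ha, h⟩ := hu
  rw [h, h, ← Finset.sum_sub_distrib]
  calc ‖∑ i ∈ s, (a i * fourier (ν i) x - a i * fourier (ν i) y)‖
      ≤ ∑ i ∈ s, ‖a i‖ * (2 * Real.pi * K * ‖x - y‖) := by
        refine norm_sum_le_of_le s fun i hi => ?_
        rw [← mul_sub, norm_mul]
        gcongr
        refine (norm_fourier_sub_le _ _ _).trans ?_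
        gcongr
        exact_mod_cast hν i hi
    _ ≤ A * (2 * Real.pi * K * ‖x - y‖) := by
        rw [← Finset.sum_mul]
        gcongr

theorem add (hu : IsTrigPoly K A u) (hu' : IsTrigPoly K A' u') :
    IsTrigPoly K (A + A') (fun x => u x + u' x) := by
  obtain ⟨ι, s, ν, a, hν, ha, h⟩ := hu
  obtain ⟨ι', s', ν', a', hν', ha', h'⟩ := hu'
  refine ⟨ι ⊕ ι', s.disjSum s', Sum.elim ν ν', Sum.elim a a', ?_, ?_, fun x => ?_⟩
  · rintro (i | i) hi
    · exact hν i (Finset.inl_mem_disjSum.1 hi)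
    · exact hν' i (Finset.inr_mem_disjSum.1 hi)
  · simpa only [Finset.sum_disjSum, Sum.elim_inl, Sum.elim_inr] using add_le_add ha ha'
  · simp only [Finset.sum_disjSum, Sum.elim_inl, Sum.elim_inr, h, h']

theorem mul (hu : IsTrigPoly K A u) (hu' : IsTrigPoly K' A' u') :
    IsTrigPoly (K + K') (A * A') (fun x => u x * u' x) := by
  have hA := hu.nonneg
  obtain ⟨ι, s, ν, a, hν, ha, h⟩ := hu
  obtain ⟨ι', s', ν', a', hν', ha', h'⟩ := hu'
  refine ⟨ι × ι', s ×ˢ s', fun i => ν i.1 + ν' i.2, fun i => a i.1 * a' i.2, ?_, ?_, fun x => ?_⟩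
  · intro i hi
    rw [Finset.mem_product] at hi
    push_cast
    exact (abs_add_le _ _).trans (add_le_add (hν _ hi.1) (hν' _ hi.2))
  · simp only [norm_mul, Finset.sum_product, ← Finset.sum_mul_sum]
    gcongr
  · simp only [h, h', Finset.sum_mul_sum, Finset.sum_product, fourier_add, mul_mul_mul_comm]

/-- Dividing the coefficients of nonzero frequency `m` by `fourier m θ - 1` solves the coboundary
equation up to the mean value `c`. -/
theorem exists_coboundary {θ : UnitAddCircle} {q : ℕ} (hu : IsTrigPoly K A u)
    (hθ : HasSmallDivisorBound θ q) (hq : 0 < q) (hK : 2 * K ≤ q) :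
    ∃ (v : UnitAddCircle → ℂ) (c : ℂ), IsTrigPoly K (q * A) v ∧ ∀ x, v (x + θ) - v x = u x - c := by
  obtain ⟨ι, s, ν, a, hν, ha, h⟩ := hu
  set b : ι → ℂ := fun i => a i / (fourier (ν i) θ - 1)
  have hdiv : ∀ i ∈ s, ν i ≠ 0 → 1 / (q : ℝ) ≤ ‖fourier (ν i) θ - 1‖ := fun i hi h0 =>
    hθ _ h0 (by have := hν i hi; omega)
  have hq' : (0 : ℝ) < 1 / q := by positivity
  refine ⟨fun x => ∑ i ∈ s with ν i ≠ 0, b i * fourier (ν i) x, ∑ i ∈ s with ¬ν i ≠ 0, a i,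
    ⟨ι, {i ∈ s | ν i ≠ 0}, ν, b, fun i hi => hν i (Finset.mem_filter.1 hi).1, ?_, fun _ => rfl⟩,
    fun x => ?_⟩
  · calc ∑ i ∈ s with ν i ≠ 0, ‖b i‖ ≤ ∑ i ∈ s with ν i ≠ 0, q * ‖a i‖ := by
          refine Finset.sum_le_sum fun i hi => ?_
          obtain ⟨his, hi0⟩ := Finset.mem_filter.1 hi
          calc ‖b i‖ ≤ ‖a i‖ / (1 / q) := by
                rw [norm_div]
                exact div_le_div_of_nonneg_left (norm_nonneg _) hq' (hdiv i his hi0)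
            _ = q * ‖a i‖ := by rw [div_div_eq_mul_div, div_one, mul_comm]
      _ ≤ ∑ i ∈ s, q * ‖a i‖ :=
          Finset.sum_le_sum_of_subset_of_nonneg (Finset.filter_subset _ _)
            fun _ _ _ => by positivity
      _ ≤ q * A := by
          rw [← Finset.mul_sum]
          gcongr
  · have hconst : ∑ i ∈ s with ¬ν i ≠ 0, a i
        = ∑ i ∈ s with ¬ν i ≠ 0, a i * fourier (ν i) x := by
      refine Finset.sum_congr rfl fun i hi => ?_
      rw [not_not.1 (Finset.mem_filter.1 hi).2, fourier_zero, mul_one]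
    rw [h, hconst, ← Finset.sum_filter_add_sum_filter_not s (fun i => ν i ≠ 0),
      add_sub_cancel_right, ← Finset.sum_sub_distrib]
    refine Finset.sum_congr rfl fun i hi => ?_
    obtain ⟨his, hi0⟩ := Finset.mem_filter.1 hi
    have hne : fourier (ν i) θ - 1 ≠ 0 := norm_pos_iff.1 (hq'.trans_le (hdiv i his hi0))
    rw [fourier_add_apply, div_mul_eq_mul_div, div_mul_eq_mul_div, ← sub_div,
      div_eq_iff hne]
    ring

/-- The mean value `c` in `exists_coboundary` is that of `u - f`, hence as small as `u - f`. -/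
theorem exists_approx_transfer {θ : UnitAddCircle} {q : ℕ} {f : UnitAddCircle → ℝ} {ε : ℝ}
    (hu : IsTrigPoly K A u) (hθ : HasSmallDivisorBound θ q) (hq : 0 < q) (hK : 2 * K ≤ q)
    (hf : Continuous f) (hf0 : ∫ x, f x = 0) (hfu : ∀ x, ‖f x - u x‖ ≤ ε) :
    ∃ v, IsTrigPoly K (q * A) v ∧ ∀ x, ‖v x + f x - v (x + θ)‖ ≤ 2 * ε := by
  obtain ⟨v, c, hv, hvc⟩ := hu.exists_coboundary hθ hq hK
  have hint {g : UnitAddCircle → ℂ} (hg : Continuous g) : Integrable g :=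
    hg.integrable_of_hasCompactSupport (.of_compactSpace g)
  have hv0 : ∫ x, (v (x + θ) - v x) = 0 := by
    rw [integral_sub (hint (by have := hv.continuous; fun_prop)) (hint hv.continuous),
      integral_add_right_eq_self v, sub_self]
  have hf0' : ∫ x, (f x : ℂ) = 0 := by
    rw [integral_complex_ofReal, hf0, Complex.ofReal_zero]
  have hmean : ∫ x, (f x - u x) = -c :=
    calc ∫ x, (f x - u x) = ∫ x, (f x - (v (x + θ) - v x) - c) := by
          simp only [hvc, sub_sub, sub_add_cancel]
      _ = -c := by
          have hvθ : Continuous fun x => v (x + θ) - v x := by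
            have := hv.continuous; fun_prop
          rw [integral_sub (hint (by fun_prop)) (hint continuous_const),
            integral_sub (hint (by fun_prop)) (hint hvθ), hf0', hv0]
          simp [measureReal_def]
  have hc : ‖c‖ ≤ ε := by
    rw [← norm_neg, ← hmean]
    simpa [measureReal_def] using norm_integral_le_of_norm_le_const (μ := volume) (ae_of_all _ hfu)
  refine ⟨v, hv, fun x => ?_⟩
  calc ‖v x + f x - v (x + θ)‖ = ‖f x - u x + c‖ := by
        rw [← sub_sub_self (u x) c, ← hvc]
        congr 1
        ring
    _ ≤ ε + ε := norm_add_le_of_le (hfu x) hc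
    _ = 2 * ε := (two_mul ε).symm

end IsTrigPoly

theorem exists_norm_fourierCoeffOn_le {f : ℝ → ℂ} (hf : Continuous f) :
    ∃ C : ℝ, ∀ m, ‖fourierCoeffOn zero_lt_one f m‖ ≤ C := by
  obtain ⟨C, hC⟩ := (isCompact_Icc (a := (0 : ℝ)) (b := 1)).exists_bound_of_continuousOn
    hf.continuousOn
  refine ⟨C, fun m => ?_⟩
  have hbound : ∀ x ∈ uIoc (0 : ℝ) 1, ‖fourier (-m) (x : AddCircle ((1 : ℝ) - 0)) • f x‖ ≤ C := by
    intro x hx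
    rw [norm_smul, fourier_apply, Circle.norm_coe, one_mul]
    exact hC x (Ioc_subset_Icc_self (uIoc_of_le (zero_le_one' ℝ) ▸ hx))
  simpa [fourierCoeffOn_eq_integral] using
    intervalIntegral.norm_integral_le_of_norm_le_const hbound

theorem abs_mul_norm_fourierCoeffOn_le {f : ℝ → ℂ} (hf : ContDiff ℝ ∞ f)
    (hp : Function.Periodic f 1) (m : ℤ) :
    |(m : ℝ)| * ‖fourierCoeffOn zero_lt_one f m‖ ≤ ‖fourierCoeffOn zero_lt_one (deriv f) m‖ := by
  rcases eq_or_ne m 0 with rfl | hm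
  · simp
  have : (0 : ℝ) < |(m : ℝ)| := by positivity
  have hpi : (1 : ℝ) ≤ 2 * Real.pi := by linarith [Real.pi_gt_three]
  have hf1 : f 1 = f 0 := by simpa using hp 0
  rw [fourierCoeffOn_of_hasDerivAt zero_lt_one hm
    (fun x _ => (hf.differentiable (by simp) x).hasDerivAt)
    ((hf.continuous_deriv (by simp)).intervalIntegrable _ _), hf1, sub_self]
  calc |(m : ℝ)| * ‖1 / (-2 * Real.pi * Complex.I * m) *
        (fourier (-m) ((0 : ℝ) : AddCircle ((1 : ℝ) - 0)) * 0 -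
          ((1 : ℝ) - (0 : ℝ)) * fourierCoeffOn zero_lt_one (deriv f) m)‖
      = ‖fourierCoeffOn zero_lt_one (deriv f) m‖ / (2 * Real.pi) := by
        have hnorm : ‖(-2 * Real.pi * Complex.I * m : ℂ)‖ = 2 * Real.pi * |(m : ℝ)| := by
          simp [abs_of_pos Real.pi_pos]
        rw [mul_zero, zero_sub, norm_mul, norm_div, norm_one, hnorm]
        simp only [Complex.ofReal_one, Complex.ofReal_zero, sub_zero, one_mul, norm_neg]
        field_simp
    _ ≤ ‖fourierCoeffOn zero_lt_one (deriv f) m‖ := div_le_self (norm_nonneg _) hpi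

theorem exists_pow_mul_norm_fourierCoeffOn_le (k : ℕ) {f : ℝ → ℂ} (hf : ContDiff ℝ ∞ f)
    (hp : Function.Periodic f 1) :
    ∃ C : ℝ, ∀ m : ℤ, |(m : ℝ)| ^ k * ‖fourierCoeffOn zero_lt_one f m‖ ≤ C := by
  induction k generalizing f with
  | zero => simpa using exists_norm_fourierCoeffOn_le hf.continuous
  | succ k ih =>
    have hp' : Function.Periodic (deriv f) 1 := fun x => by
      rw [← deriv_comp_add_const, funext hp]
    obtain ⟨C, hC⟩ := ih (contDiff_infty_iff_deriv.1 hf).2 hp'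
    refine ⟨C, fun m => ?_⟩
    rw [pow_succ, mul_assoc]
    exact (mul_le_mul_of_nonneg_left (abs_mul_norm_fourierCoeffOn_le hf hp m)
      (by positivity)).trans (hC m)

theorem fourierCoeff_eq_fourierCoeffOn (g : UnitAddCircle → ℂ) (m : ℤ) :
    fourierCoeff g m = fourierCoeffOn zero_lt_one (fun t : ℝ => g t) m := by
  rw [fourierCoeff_eq_intervalIntegral g m 0, fourierCoeffOn_eq_integral]
  norm_num

/-- The Fourier coefficients of `g` decrease faster than any power of the frequency. -/
def RapidFourierDecay (g : UnitAddCircle → ℂ) : Prop :=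
  ∀ k : ℕ, Summable fun m : ℤ => |(m : ℝ)| ^ k * ‖fourierCoeff g m‖

theorem rapidFourierDecay_of_contDiff {g : UnitAddCircle → ℂ}
    (hg : ContDiff ℝ ∞ fun t : ℝ => g t) : RapidFourierDecay g := by
  intro k
  have hp : Function.Periodic (fun t : ℝ => g t) 1 := fun t => by simp
  obtain ⟨C, hC⟩ := exists_pow_mul_norm_fourierCoeffOn_le (k + 2) hg hp
  refine ((Real.summable_one_div_int_pow.2 one_lt_two).mul_left C).of_norm_bounded_eventually ?_
  filter_upwards [(Set.finite_singleton (0 : ℤ)).compl_mem_cofinite] with m hm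
  have hm' : (m : ℝ) ≠ 0 := Int.cast_ne_zero.2 hm
  rw [Real.norm_of_nonneg (by positivity), mul_one_div, le_div_iff₀ (by positivity)]
  calc |(m : ℝ)| ^ k * ‖fourierCoeff g m‖ * (m : ℝ) ^ 2
      = |(m : ℝ)| ^ (k + 2) * ‖fourierCoeff g m‖ := by rw [← sq_abs (m : ℝ)]; ring
    _ ≤ C := by rw [fourierCoeff_eq_fourierCoeffOn]; exact hC m

namespace RapidFourierDecay

variable {g : C(UnitAddCircle, ℂ)}

theorem norm_sub_partialSum_le (hg : RapidFourierDecay g) (k K : ℕ) (x : UnitAddCircle) :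
    ‖g x - ∑ m ∈ Finset.Icc (-K : ℤ) K, fourierCoeff g m * fourier m x‖
      ≤ (∑' m : ℤ, |(m : ℝ)| ^ k * ‖fourierCoeff g m‖) / (K + 1) ^ k := by
  have hsum : Summable (fourierCoeff g) := .of_norm (by simpa using hg 0)
  have hseries := has_pointwise_sum_fourier_series_of_summable hsum x
  set s : Finset ℤ := Finset.Icc (-K : ℤ) K
  have htail : g x - ∑ m ∈ s, fourierCoeff g m * fourier m x
      = ∑' m : ↥(s : Set ℤ)ᶜ, fourierCoeff g m • fourier (m : ℤ) x := by
    rw [← hseries.tsum_eq, ← hseries.summable.sum_add_tsum_compl (s := s)]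
    simp only [smul_eq_mul, add_sub_cancel_left]
  have hfar : ∀ m : ↥(s : Set ℤ)ᶜ, ‖fourierCoeff g m • fourier (m : ℤ) x‖
      ≤ |((m : ℤ) : ℝ)| ^ k * ‖fourierCoeff g m‖ / (K + 1) ^ k := by
    intro ⟨m, hm⟩
    have hKm : (K : ℝ) + 1 ≤ |(m : ℝ)| := by
      have : (K : ℤ) + 1 ≤ |m| := by
        by_contra! h
        exact hm (Finset.mem_coe.2 (Finset.mem_Icc.2 (abs_le.1 (Int.le_of_lt_add_one h))))
      exact_mod_cast this
    rw [norm_smul, fourier_apply, Circle.norm_coe, mul_one, le_div_iff₀ (by positivity), mul_comm]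
    gcongr
  rw [htail]
  refine (tsum_of_norm_bounded (((hg k).subtype _).div_const _).hasSum hfar).trans ?_
  rw [tsum_div_const]
  gcongr
  exact (hg k).tsum_subtype_le _ _ fun _ => by positivity

theorem isTrigPoly_partialSum (hg : RapidFourierDecay g) (K : ℕ) :
    IsTrigPoly K (∑' m : ℤ, ‖fourierCoeff g m‖)
      (fun x => ∑ m ∈ Finset.Icc (-K : ℤ) K, fourierCoeff g m * fourier m x) :=
  ⟨ℤ, Finset.Icc (-K : ℤ) K, id, fourierCoeff g, fun _ hm => abs_le.2 (Finset.mem_Icc.1 hm),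
    Summable.sum_le_tsum _ (fun _ _ => norm_nonneg _) (by simpa using hg 0), fun _ => rfl⟩

theorem eventually_exists_isTrigPoly (hg : RapidFourierDecay g) (B : ℕ) :
    ∀ᶠ q : ℕ in atTop, ∃ p, IsTrigPoly (q / 4) q p ∧ ∀ x, ‖g x - p x‖ ≤ 1 / (q : ℝ) ^ B := by
  set S : ℝ := ∑' m : ℤ, |(m : ℝ)| ^ (B + 1) * ‖fourierCoeff g m‖
  filter_upwards [eventually_ge_atTop 1,
    tendsto_natCast_atTop_atTop.eventually_ge_atTop (∑' m : ℤ, ‖fourierCoeff g m‖),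
    tendsto_natCast_atTop_atTop.eventually_ge_atTop (S * 4 ^ (B + 1))] with q hq hqA hqS
  refine ⟨_, (hg.isTrigPoly_partialSum (q / 4)).mono le_rfl hqA, fun x => ?_⟩
  have : (0 : ℝ) < q := by positivity
  have hK : (q : ℝ) / 4 ≤ (q / 4 : ℕ) + 1 := by
    rw [div_le_iff₀ four_pos]
    exact_mod_cast (by omega : q ≤ (q / 4 + 1) * 4)
  calc _ ≤ S / ((q / 4 : ℕ) + 1) ^ (B + 1) := hg.norm_sub_partialSum_le (B + 1) (q / 4) x
    _ ≤ S / ((q : ℝ) / 4) ^ (B + 1) := by gcongr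
    _ = S * 4 ^ (B + 1) / q ^ (B + 1) := by rw [div_pow, div_div_eq_mul_div]
    _ ≤ q / q ^ (B + 1) := by gcongr
    _ = 1 / (q : ℝ) ^ B := by rw [pow_succ']; field_simp

end RapidFourierDecay

/-! ### Cocycles in the Heisenberg group -/

section Cocycle

variable {X G : Type*}

/-- The cocycle `M x * M (T x) * ⋯ * M (T^[n - 1] x)` over `T` that is generated by `M`. -/
def cocycle [Monoid G] (T : X → X) (M : X → G) : ℕ → X → G
  | 0, _ => 1
  | n + 1, x => M x * cocycle T M n (T x)

/-- The generator that results from `M` by the change of coordinates `W` and the removal of the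
constant `z`. -/
def transferred [Group G] (T : X → X) (M W : X → G) (z : G) (x : X) : G :=
  W x * M x * (W (T x))⁻¹ * z⁻¹

theorem cocycle_eq_transferred [Group G] (T : X → X) (M W : X → G) {z : G}
    (hz : z ∈ Subgroup.center G) (n : ℕ) (x : X) :
    cocycle T M n x =
      (W x)⁻¹ * cocycle T (transferred T M W z) n x * z ^ n * W (T^[n] x) := by
  induction n generalizing x with
  | zero => simp [cocycle]
  | succ n ih =>
    have hcomm (g h : G) : z⁻¹ * (g * (z * h)) = g * h := by
      rw [← mul_assoc g, Subgroup.mem_center_iff.1 hz, mul_assoc, inv_mul_cancel_left]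
    rw [cocycle, cocycle, ih, transferred, Function.iterate_succ_apply, pow_succ']
    simp only [mul_assoc, inv_mul_cancel_left, hcomm]

end Cocycle

namespace Heis

/-- The matrix entries as coordinates. -/
def entries : Heis ≃ₜ ℝ × ℝ × ℝ :=
  Equiv.toHomeomorphOfIsInducing
    ⟨fun g => (g.a, g.b, g.c), fun v => ⟨v.1, v.2.1, v.2.2⟩, fun _ => rfl, fun _ => rfl⟩ ⟨rfl⟩

/-- The largest absolute value of the entries above the diagonal. It is neither subadditive nor
invariant under inversion, but it is so to first order near the identity, and the ball of radius `r`
is a Euclidean cube. -/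
instance : Norm Heis := ⟨fun g => ‖entries g‖⟩

theorem norm_entries (g : Heis) : ‖entries g‖ = ‖g‖ := rfl

theorem norm_entries_sub_le_iff {g h : Heis} {r : ℝ} :
    ‖entries g - entries h‖ ≤ r ↔ |g.a - h.a| ≤ r ∧ |g.b - h.b| ≤ r ∧ |g.c - h.c| ≤ r := by
  simp only [norm_prod_le_iff]
  rfl

theorem norm_le_iff {g : Heis} {r : ℝ} : ‖g‖ ≤ r ↔ |g.a| ≤ r ∧ |g.b| ≤ r ∧ |g.c| ≤ r := by
  simp only [← norm_entries, norm_prod_le_iff]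
  rfl

theorem abs_a_le (g : Heis) : |g.a| ≤ ‖g‖ := (norm_le_iff.1 le_rfl).1

theorem abs_b_le (g : Heis) : |g.b| ≤ ‖g‖ := (norm_le_iff.1 le_rfl).2.1

theorem abs_c_le (g : Heis) : |g.c| ≤ ‖g‖ := (norm_le_iff.1 le_rfl).2.2

protected theorem norm_nonneg (g : Heis) : 0 ≤ ‖g‖ := norm_nonneg (entries g)

protected theorem norm_one : ‖(1 : Heis)‖ = 0 := norm_zero (E := ℝ × ℝ × ℝ)

protected theorem norm_mul_le (g h : Heis) : ‖g * h‖ ≤ ‖g‖ + ‖h‖ + ‖g‖ * ‖h‖ := by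
  have hg := Heis.norm_nonneg g
  have hh := Heis.norm_nonneg h
  have hgh : 0 ≤ ‖g‖ * ‖h‖ := by positivity
  refine norm_le_iff.2 ⟨?_, ?_, ?_⟩
  · exact (abs_add_le _ _).trans (by linarith [abs_a_le g, abs_a_le h])
  · exact (abs_add_le _ _).trans (by linarith [abs_b_le g, abs_b_le h])
  · have hab : |g.a * h.b| ≤ ‖g‖ * ‖h‖ := by
      rw [abs_mul]
      exact mul_le_mul (abs_a_le g) (abs_b_le h) (abs_nonneg _) hg
    exact (abs_add_three _ _ _).trans (by linarith [abs_c_le g, abs_c_le h])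

theorem norm_inv_le (g : Heis) : ‖g⁻¹‖ ≤ ‖g‖ + ‖g‖ ^ 2 := by
  have hg := Heis.norm_nonneg g
  refine norm_le_iff.2 ⟨?_, ?_, ?_⟩
  · rw [inv_a, abs_neg]
    nlinarith [abs_a_le g]
  · rw [inv_b, abs_neg]
    nlinarith [abs_b_le g]
  · have hab : |g.a * g.b| ≤ ‖g‖ ^ 2 := by
      rw [abs_mul, sq]
      exact mul_le_mul (abs_a_le g) (abs_b_le g) (abs_nonneg _) hg
    exact (abs_sub _ _).trans (by linarith [abs_c_le g])

theorem norm_conj_le (g h : Heis) : ‖h⁻¹ * g * h‖ ≤ (1 + 2 * ‖h‖) * ‖g‖ := by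
  have hg := Heis.norm_nonneg g
  have hh := Heis.norm_nonneg h
  have hgh : 0 ≤ ‖g‖ * ‖h‖ := by positivity
  refine norm_le_iff.2 ⟨?_, ?_, ?_⟩
  · have ha : (h⁻¹ * g * h).a = g.a := by simp
    rw [ha]
    linarith [abs_a_le g]
  · have hb : (h⁻¹ * g * h).b = g.b := by simp
    rw [hb]
    linarith [abs_b_le g]
  · have hc : (h⁻¹ * g * h).c = g.c + g.a * h.b - h.a * g.b := by
      simp only [mul_c, mul_a, inv_a, inv_c]
      ring
    have hab : |g.a * h.b| ≤ ‖g‖ * ‖h‖ := by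
      rw [abs_mul]
      exact mul_le_mul (abs_a_le g) (abs_b_le h) (abs_nonneg _) hg
    have hba : |h.a * g.b| ≤ ‖h‖ * ‖g‖ := by
      rw [abs_mul]
      exact mul_le_mul (abs_a_le h) (abs_b_le g) (abs_nonneg _) hh
    rw [hc]
    linarith [abs_sub (g.c + g.a * h.b) (h.a * g.b), abs_add_le g.c (g.a * h.b), abs_c_le g]

theorem norm_inv_mul_le (g h : Heis) :
    ‖g⁻¹ * h‖ ≤ (1 + ‖g‖) * ‖entries h - entries g‖ := by
  set d : ℝ := ‖entries h - entries g‖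
  obtain ⟨hda, hdb, hdc⟩ := norm_entries_sub_le_iff.1 (le_refl d)
  have hg := Heis.norm_nonneg g
  have hgd : 0 ≤ ‖g‖ * d := mul_nonneg hg (norm_nonneg _)
  refine norm_le_iff.2 ⟨?_, ?_, ?_⟩
  · have ha : (g⁻¹ * h).a = h.a - g.a := by
      simp only [mul_a, inv_a]
      ring
    rw [ha]
    linarith
  · have hb : (g⁻¹ * h).b = h.b - g.b := by
      simp only [mul_b, inv_b]
      ring
    rw [hb]
    linarith
  · have hc : (g⁻¹ * h).c = (h.c - g.c) - g.a * (h.b - g.b) := by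
      simp only [mul_c, inv_a, inv_c]
      ring
    have hab : |g.a * (h.b - g.b)| ≤ ‖g‖ * d := by
      rw [abs_mul]
      exact mul_le_mul (abs_a_le g) hdb (abs_nonneg _) hg
    rw [hc]
    exact (abs_sub _ _).trans (by linarith)

theorem norm_cocycle_le {X : Type*} {T : X → X} {E : X → Heis} {e : ℝ} (hE : ∀ x, ‖E x‖ ≤ e)
    (n : ℕ) (x : X) : ‖cocycle T E n x‖ ≤ (1 + e) ^ n - 1 := by
  induction n generalizing x with
  | zero => simp [cocycle, Heis.norm_one]
  | succ n ih =>
    have he : 0 ≤ e := (Heis.norm_nonneg _).trans (hE x)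
    calc ‖cocycle T E (n + 1) x‖
        ≤ ‖E x‖ + ‖cocycle T E n (T x)‖ + ‖E x‖ * ‖cocycle T E n (T x)‖ := Heis.norm_mul_le _ _
      _ ≤ e + ((1 + e) ^ n - 1) + e * ((1 + e) ^ n - 1) := by
          gcongr
          exacts [hE x, ih _, Heis.norm_nonneg _, hE x, ih _]
      _ = (1 + e) ^ (n + 1) - 1 := by ring

theorem norm_cocycle_le_two_mul {X : Type*} {T : X → X} {E : X → Heis} {e : ℝ}
    (hE : ∀ x, ‖E x‖ ≤ e) {n : ℕ} (hn : n * e ≤ 1) (x : X) :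
    ‖cocycle T E n x‖ ≤ 2 * (n * e) := by
  have he : 0 ≤ e := (Heis.norm_nonneg _).trans (hE x)
  have hne : 0 ≤ n * e := by positivity
  calc ‖cocycle T E n x‖ ≤ (1 + e) ^ n - 1 := norm_cocycle_le hE n x
    _ ≤ Real.exp (n * e) - 1 := by
        rw [Real.exp_nat_mul]
        gcongr
        linarith [Real.add_one_le_exp e]
    _ ≤ |Real.exp (n * e) - 1| := le_abs_self _
    _ ≤ 2 * |n * e| := Real.abs_exp_sub_one_le (by rwa [abs_of_nonneg hne])
    _ = 2 * (n * e) := by rw [abs_of_nonneg hne]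

theorem norm_inv_mul_mul_le {g h w : Heis} {s : ℝ} (hg : ‖g‖ ≤ s) (hh : ‖h‖ ≤ s) (hw : ‖w‖ ≤ s)
    (hs : s ≤ 1) : ‖g⁻¹ * w * h‖ ≤ 11 * s := by
  have hs0 : 0 ≤ s := (Heis.norm_nonneg g).trans hg
  have hss : s * s ≤ s := mul_le_of_le_one_right hs0 hs
  have hinv : ‖g⁻¹‖ ≤ 2 * s := by nlinarith [norm_inv_le g, Heis.norm_nonneg g]
  have hmul : ‖g⁻¹ * w‖ ≤ 5 * s := by
    nlinarith [Heis.norm_mul_le g⁻¹ w, mul_le_mul hinv hw (Heis.norm_nonneg w) (by positivity)]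
  nlinarith [Heis.norm_mul_le (g⁻¹ * w) h, mul_le_mul hmul hh (Heis.norm_nonneg h) (by positivity)]

theorem kap_eq_norm_inv (g : Heis) : kap g = ‖g⁻¹‖ := by
  refine eq_of_forall_ge_iff fun r => ?_
  rw [norm_le_iff, kap, max_le_iff, max_le_iff, inv_a, inv_b, inv_c, abs_neg, abs_neg,
    abs_sub_comm g.c]
  tauto

end Heis

/-! ### Approximate conjugation to a central constant -/

/-- The change of coordinates `W` turns the generator `M` over the rotation by `θ` into the central
constant `z` up to an error of size `e`; the constant `L` bounds both the entries of `W` and their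
Lipschitz constants. -/
structure IsApproxConj (θ : UnitAddCircle) (M W : UnitAddCircle → Heis) (z : Heis) (L e : ℝ) :
    Prop where
  norm_le : ∀ x, ‖W x‖ ≤ L
  lipschitz : ∀ x y, ‖(W x).entries - (W y).entries‖ ≤ L * ‖x - y‖
  mem_center : z ∈ Subgroup.center Heis
  error : ∀ x, ‖transferred (· + θ) M W z x‖ ≤ e

theorem mk_zero_zero_mem_center (c : ℝ) : (⟨0, 0, c⟩ : Heis) ∈ Subgroup.center Heis :=
  Subgroup.mem_center_iff.2 fun g => by ext <;> simp [add_comm]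

namespace IsTrigPoly

variable {q : ℕ} {u : UnitAddCircle → ℂ}

theorem abs_re_le (hu : IsTrigPoly q (q ^ 5) u) (hq : (7 : ℝ) ≤ q) (x : UnitAddCircle) :
    |(u x).re| ≤ (q : ℝ) ^ 7 :=
  (Complex.abs_re_le_norm _).trans
    ((hu.norm_le x).trans (pow_le_pow_right₀ (by linarith) (by norm_num)))

theorem abs_re_sub_re_le (hu : IsTrigPoly q (q ^ 5) u) (hq : (7 : ℝ) ≤ q)
    (x y : UnitAddCircle) : |(u x).re - (u y).re| ≤ (q : ℝ) ^ 7 * ‖x - y‖ := by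
  rw [← Complex.sub_re]
  calc |(u x - u y).re| ≤ ‖u x - u y‖ := Complex.abs_re_le_norm _
    _ ≤ q ^ 5 * (2 * Real.pi * q * ‖x - y‖) := hu.norm_sub_le x y
    _ ≤ q ^ 5 * (q * q * ‖x - y‖) := by
        gcongr
        linarith [Real.pi_lt_d2]
    _ = q ^ 7 * ‖x - y‖ := by ring

end IsTrigPoly

/-- In the corner entry of the error the product `v * pg` cancels against the coboundary of `s`, up
to the approximation error of `g` and a multiple of the first entry of the error. -/
theorem norm_transferred_re_le {θ : UnitAddCircle} {f g h : UnitAddCircle → ℝ}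
    {v w s pg ph : UnitAddCircle → ℂ} {c : ℂ} {Q ε : ℝ} (hQ : 1 ≤ Q)
    (hv : ∀ x, ‖v x‖ ≤ Q) (hw : ∀ x, ‖w x‖ ≤ Q)
    (hvf : ∀ x, ‖v x + f x - v (x + θ)‖ ≤ 2 * ε) (hwg : ∀ x, ‖w x + g x - w (x + θ)‖ ≤ 2 * ε)
    (hgp : ∀ x, ‖g x - pg x‖ ≤ ε) (hhp : ∀ x, ‖h x - ph x‖ ≤ ε)
    (hs : ∀ x, s (x + θ) - s x = v x * pg x + ph x - c) (x : UnitAddCircle) :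
    ‖transferred (· + θ) (fun x => ⟨f x, g x, h x⟩)
      (fun x => (⟨(v x).re, (w x).re, (s x).re⟩ : Heis)) ⟨0, 0, c.re⟩ x‖ ≤ 4 * Q * ε := by
  have hε : 0 ≤ ε := (norm_nonneg _).trans (hgp x)
  have hQε : ε ≤ Q * ε := le_mul_of_one_le_left hε hQ
  have ha : |(v x).re + f x - (v (x + θ)).re| ≤ 2 * ε := by
    simpa using (Complex.abs_re_le_norm _).trans (hvf x)
  have hb : |(w x).re + g x - (w (x + θ)).re| ≤ 2 * ε := by
    simpa using (Complex.abs_re_le_norm _).trans (hwg x)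
  refine Heis.norm_le_iff.2 ⟨?_, ?_, ?_⟩
  · simp only [transferred, Heis.mul_a, Heis.inv_a, neg_zero, add_zero, ← sub_eq_add_neg]
    linarith
  · simp only [transferred, Heis.mul_b, Heis.inv_b, neg_zero, add_zero, ← sub_eq_add_neg]
    linarith
  · have hcorner : (transferred (· + θ) (fun x => ⟨f x, g x, h x⟩)
          (fun x => (⟨(v x).re, (w x).re, (s x).re⟩ : Heis)) ⟨0, 0, c.re⟩ x).c
        = (h x - ph x).re + (v x * (g x - pg x)).re
          - ((v x).re + f x - (v (x + θ)).re) * (w (x + θ)).re := by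
      have hsre := congrArg Complex.re (hs x)
      simp only [Complex.sub_re, Complex.add_re, Complex.mul_re] at hsre
      simp only [transferred, Heis.mul_c, Heis.mul_a, Heis.inv_c, Heis.inv_a, Heis.inv_b,
        Complex.sub_re, Complex.sub_im, Complex.mul_re, Complex.ofReal_re, Complex.ofReal_im]
      linear_combination -hsre
    have hh : |(h x - ph x).re| ≤ ε := (Complex.abs_re_le_norm _).trans (hhp x)
    have hvg : |(v x * (g x - pg x)).re| ≤ Q * ε := by
      refine (Complex.abs_re_le_norm _).trans ?_
      rw [norm_mul]
      exact mul_le_mul (hv x) (hgp x) (norm_nonneg _) (by linarith)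
    have hfw : |((v x).re + f x - (v (x + θ)).re) * (w (x + θ)).re| ≤ 2 * ε * Q := by
      rw [abs_mul]
      exact mul_le_mul ha ((Complex.abs_re_le_norm _).trans (hw _)) (abs_nonneg _) (by linarith)
    rw [hcorner]
    refine (abs_sub _ _).trans ((add_le_add_left (abs_add_le _ _) _).trans ?_)
    linarith

theorem exists_isApproxConj {θ : UnitAddCircle} {q : ℕ} (hθ : HasSmallDivisorBound θ q)
    (hq : 7 ≤ q) {f g h : UnitAddCircle → ℝ} {pf pg ph : UnitAddCircle → ℂ} {ε : ℝ}
    (hf : Continuous f) (hg : Continuous g) (hf0 : ∫ x, f x = 0) (hg0 : ∫ x, g x = 0)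
    (hpf : IsTrigPoly (q / 4) q pf) (hpg : IsTrigPoly (q / 4) q pg)
    (hph : IsTrigPoly (q / 4) q ph) (hfp : ∀ x, ‖f x - pf x‖ ≤ ε)
    (hgp : ∀ x, ‖g x - pg x‖ ≤ ε) (hhp : ∀ x, ‖h x - ph x‖ ≤ ε) :
    ∃ W z, IsApproxConj θ (fun x => ⟨f x, g x, h x⟩) W z (q ^ 7) (4 * (q * q) * ε) := by
  have hq7 : (7 : ℝ) ≤ q := by exact_mod_cast hq
  obtain ⟨v, hv, hvf⟩ := hpf.exists_approx_transfer hθ (by omega) (by omega) hf hf0 hfp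
  obtain ⟨w, hw, hwg⟩ := hpg.exists_approx_transfer hθ (by omega) (by omega) hg hg0 hgp
  have hu := (hv.mul hpg).add (hph.mono (Nat.le_add_right _ (q / 4)) le_rfl)
  obtain ⟨s, c, hs, hsc⟩ := hu.exists_coboundary hθ (by omega) (by omega)
  have hqq : (q : ℝ) * q ≤ q ^ 5 := by
    rw [← sq]
    exact pow_le_pow_right₀ (by linarith) (by norm_num)
  have hqqq : (q : ℝ) * (q * q * q + q) ≤ q ^ 5 :=
    calc (q : ℝ) * (q * q * q + q) = q ^ 4 + q ^ 2 * 1 := by ring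
      _ ≤ q ^ 4 + q ^ 2 * q ^ 2 := by gcongr; nlinarith
      _ = q ^ 4 * 2 := by ring
      _ ≤ q ^ 4 * q := by gcongr; linarith
      _ = q ^ 5 := by ring
  have hv5 : IsTrigPoly q (q ^ 5) v := hv.mono (by omega) hqq
  have hw5 : IsTrigPoly q (q ^ 5) w := hw.mono (by omega) hqq
  have hs5 : IsTrigPoly q (q ^ 5) s := hs.mono (by omega) hqqq
  refine ⟨fun x => ⟨(v x).re, (w x).re, (s x).re⟩, ⟨0, 0, c.re⟩, fun x => ?_, fun x y => ?_,
    mk_zero_zero_mem_center _,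
    norm_transferred_re_le (by nlinarith) hv.norm_le hw.norm_le hvf hwg hgp hhp hsc⟩
  · exact Heis.norm_le_iff.2
      ⟨hv5.abs_re_le hq7 x, hw5.abs_re_le hq7 x, hs5.abs_re_le hq7 x⟩
  · exact Heis.norm_entries_sub_le_iff.2 ⟨hv5.abs_re_sub_re_le hq7 x y,
      hw5.abs_re_sub_re_le hq7 x y, hs5.abs_re_sub_re_le hq7 x y⟩

theorem continuous_of_continuous_comp_coe {Y : Type*} [TopologicalSpace Y] {f : UnitAddCircle → Y}
    (hf : Continuous fun t : ℝ => f t) : Continuous f :=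
  isQuotientMap_quotient_mk'.continuous_iff.2 hf

theorem eventually_exists_isTrigPoly_of_contDiff {f : UnitAddCircle → ℝ}
    (hf : ContDiff ℝ ∞ fun t : ℝ => f t) (B : ℕ) :
    ∀ᶠ q : ℕ in atTop, ∃ p, IsTrigPoly (q / 4) q p ∧ ∀ x, ‖f x - p x‖ ≤ 1 / (q : ℝ) ^ B := by
  have hfc : Continuous f := continuous_of_continuous_comp_coe hf.continuous
  have hdecay : RapidFourierDecay fun x => (f x : ℂ) :=
    rapidFourierDecay_of_contDiff (Complex.ofRealCLM.contDiff.comp hf)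
  exact RapidFourierDecay.eventually_exists_isTrigPoly
    (g := ⟨fun x => (f x : ℂ), by fun_prop⟩) hdecay B

theorem eventually_exists_isApproxConj (θ : UnitAddCircle) {f g h : UnitAddCircle → ℝ}
    (hf : ContDiff ℝ ∞ fun t : ℝ => f t) (hg : ContDiff ℝ ∞ fun t : ℝ => g t)
    (hh : ContDiff ℝ ∞ fun t : ℝ => h t) (hf0 : ∫ x, f x = 0) (hg0 : ∫ x, g x = 0) (B : ℕ) :
    ∀ᶠ q : ℕ in atTop, HasSmallDivisorBound θ q →
      ∃ W z, IsApproxConj θ (fun x => ⟨f x, g x, h x⟩) W z (q ^ 7) (1 / q ^ B) := by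
  filter_upwards [eventually_ge_atTop 7, eventually_exists_isTrigPoly_of_contDiff hf (B + 3),
    eventually_exists_isTrigPoly_of_contDiff hg (B + 3),
    eventually_exists_isTrigPoly_of_contDiff hh (B + 3)]
    with q hq ⟨pf, hpf, hfp⟩ ⟨pg, hpg, hgp⟩ ⟨ph, hph, hhp⟩ hθ
  have hq7 : (7 : ℝ) ≤ q := by exact_mod_cast hq
  obtain ⟨W, z, hWz⟩ := exists_isApproxConj hθ hq
    (continuous_of_continuous_comp_coe hf.continuous)
    (continuous_of_continuous_comp_coe hg.continuous) hf0 hg0 hpf hpg hph hfp hgp hhp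
  refine ⟨W, z, hWz.norm_le, hWz.lipschitz, hWz.mem_center, fun x => (hWz.error x).trans ?_⟩
  calc 4 * (q * q) * (1 / (q : ℝ) ^ (B + 3)) ≤ q * (q * q) * (1 / (q : ℝ) ^ (B + 3)) := by
        gcongr
        linarith
    _ = 1 / (q : ℝ) ^ B := by
        rw [pow_add]
        field_simp

/-! ### Covering by orbits -/

/-- The point of the phase space over `x` that `g` represents. -/
def Phase.mk (x : UnitAddCircle) (g : Heis) : Phase := (x, Nil.mk g)

/-- The skew product over the rotation by `θ` whose generator `M` acts by right translations. -/
def skewProd (θ : UnitAddCircle) (M : UnitAddCircle → Heis) (p : Phase) : Phase :=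
  (p.1 + θ, p.2.rmul (M p.1))

theorem skewProd_iterate_mk (θ : UnitAddCircle) (M : UnitAddCircle → Heis) (n : ℕ)
    (x : UnitAddCircle) (g : Heis) :
    (skewProd θ M)^[n] (Phase.mk x g) =
      Phase.mk ((· + θ)^[n] x) (g * cocycle (· + θ) M n x) := by
  induction n generalizing x g with
  | zero => simp [cocycle]
  | succ n ih =>
    have hstep : skewProd θ M (Phase.mk x g) = Phase.mk (x + θ) (g * M x) := rfl
    rw [Function.iterate_succ_apply, Function.iterate_succ_apply, hstep, ih, cocycle, mul_assoc]

/-- The base points are at distance at most `δ`, and the fibre coordinates have representatives that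
differ by an element of the Heisenberg group of norm at most `δ`. -/
def Close (δ : ℝ) (p q : Phase) : Prop :=
  ‖p.1 - q.1‖ ≤ δ ∧ ∃ g h, Nil.mk g = p.2 ∧ Nil.mk h = q.2 ∧ ‖h⁻¹ * g‖ ≤ δ

theorem Close.mono {δ δ' : ℝ} {p q : Phase} (hpq : Close δ p q) (hδ : δ ≤ δ') : Close δ' p q := by
  obtain ⟨hx, g, h, hg, hh, hgh⟩ := hpq
  exact ⟨hx.trans hδ, g, h, hg, hh, hgh.trans hδ⟩

namespace IsApproxConj

variable {θ : UnitAddCircle} {M W : UnitAddCircle → Heis} {z : Heis} {L e s : ℝ}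

theorem norm_inv_mul_conj_le (hW : IsApproxConj θ M W z L e) (hL : 1 ≤ L) {g : Heis}
    (hLs : 33 * L * s ≤ 1) (hg : ‖g‖ ≤ 11 * s) {x y : UnitAddCircle} (hxy : ‖x - y‖ ≤ s) :
    ‖(W y)⁻¹ * g * W x‖ ≤ 37 * L ^ 2 * s := by
  have hs : 0 ≤ s := (norm_nonneg _).trans hxy
  have hconj : ‖(W y)⁻¹ * g * W y‖ ≤ 33 * L * s :=
    calc ‖(W y)⁻¹ * g * W y‖ ≤ (1 + 2 * ‖W y‖) * ‖g‖ := Heis.norm_conj_le _ _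
      _ ≤ (L + 2 * L) * (11 * s) := by
          gcongr
          exacts [Heis.norm_nonneg g, hW.norm_le y]
      _ = 33 * L * s := by ring
  have hshift : ‖(W y)⁻¹ * W x‖ ≤ 2 * L ^ 2 * s :=
    calc ‖(W y)⁻¹ * W x‖ ≤ (1 + ‖W y‖) * ‖(W x).entries - (W y).entries‖ :=
          Heis.norm_inv_mul_le _ _
      _ ≤ (L + L) * (L * s) := by
          gcongr
          exacts [hW.norm_le y, (hW.lipschitz x y).trans (by gcongr)]
      _ = 2 * L ^ 2 * s := by ring
  have hsplit : (W y)⁻¹ * g * W x = (W y)⁻¹ * g * W y * ((W y)⁻¹ * W x) := by group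
  rw [hsplit]
  calc _ ≤ 33 * L * s + 2 * L ^ 2 * s + 33 * L * s * (2 * L ^ 2 * s) := by
        refine (Heis.norm_mul_le _ _).trans ?_
        gcongr
        exact Heis.norm_nonneg _
    _ ≤ 33 * L ^ 2 * s + 2 * L ^ 2 * s + 1 * (2 * L ^ 2 * s) := by
        gcongr
        nlinarith
    _ = 37 * L ^ 2 * s := by ring

/-- The central constant commutes with everything and therefore cancels in the difference of two
orbits, however large its power is. -/
theorem close_iterate (hW : IsApproxConj θ M W z L e) (hL : 1 ≤ L) (hLs : 33 * L * s ≤ 1) {n : ℕ}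
    (hn : 2 * (n * e) ≤ s) {x y : UnitAddCircle} {u v : Heis} (hxy : ‖x - y‖ ≤ s)
    (huv : ‖v⁻¹ * u‖ ≤ s) :
    Close (37 * L ^ 2 * s) ((skewProd θ M)^[n] (Phase.mk x (u * W x)))
      ((skewProd θ M)^[n] (Phase.mk y (v * W y))) := by
  have hs : 0 ≤ s := (norm_nonneg _).trans hxy
  have hs1 : s ≤ 1 := by nlinarith
  have hsL : s ≤ 37 * L ^ 2 * s := le_mul_of_one_le_left hs (by nlinarith)
  have hrot : ‖(· + θ)^[n] x - (· + θ)^[n] y‖ ≤ s := by simpa using hxy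
  let P := fun x => cocycle (· + θ) (transferred (· + θ) M W z) n x
  have hP (x) : ‖P x‖ ≤ s :=
    (Heis.norm_cocycle_le_two_mul hW.error (by linarith) x).trans hn
  have hzn : z ^ n ∈ Subgroup.center Heis := pow_mem hW.mem_center n
  have hcentral (g : Heis) : (z ^ n)⁻¹ * (g * z ^ n) = g := by
    rw [Subgroup.mem_center_iff.1 hzn, inv_mul_cancel_left]
  rw [skewProd_iterate_mk, skewProd_iterate_mk]
  refine ⟨hrot.trans hsL, _, _, rfl, rfl, ?_⟩
  have hdiff : (v * W y * cocycle (· + θ) M n y)⁻¹ * (u * W x * cocycle (· + θ) M n x) =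
      (W ((· + θ)^[n] y))⁻¹ * ((P y)⁻¹ * (v⁻¹ * u) * P x) * W ((· + θ)^[n] x) := by
    rw [cocycle_eq_transferred (· + θ) M W hW.mem_center,
      cocycle_eq_transferred (· + θ) M W hW.mem_center,
      ← hcentral ((P y)⁻¹ * (v⁻¹ * u) * P x)]
    simp only [P]
    group
  rw [hdiff]
  exact hW.norm_inv_mul_conj_le hL hLs (Heis.norm_inv_mul_mul_le (hP y) (hP x) huv hs1) hrot

end IsApproxConj

theorem exists_gam_mul_mem_Ico (g : Heis) : ∃ γ ∈ Gam, (γ * g).a ∈ Ico (0 : ℝ) 1 ∧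
    (γ * g).b ∈ Ico (0 : ℝ) 1 ∧ (γ * g).c ∈ Ico (0 : ℝ) 1 := by
  have hfract (x : ℝ) : ((-⌊x⌋ : ℤ) : ℝ) + x ∈ Ico (0 : ℝ) 1 := by
    rw [Int.cast_neg, neg_add_eq_sub, Int.self_sub_floor]
    exact ⟨Int.fract_nonneg x, Int.fract_lt_one x⟩
  refine ⟨⟨(-⌊g.a⌋ : ℤ), (-⌊g.b⌋ : ℤ), (-⌊g.c + (-⌊g.a⌋ : ℤ) * g.b⌋ : ℤ)⟩,
    ⟨⟨_, rfl⟩, ⟨_, rfl⟩, ⟨_, rfl⟩⟩, hfract _, hfract _, ?_⟩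
  rw [Heis.mul_c, add_assoc]
  exact hfract _

/-- The elements with entries in `[0, 1]`. This set is compact and contains a representative of each
coset of the lattice. -/
def unitCube : Set Heis := {u | u.a ∈ Icc (0 : ℝ) 1 ∧ u.b ∈ Icc (0 : ℝ) 1 ∧ u.c ∈ Icc (0 : ℝ) 1}

theorem norm_le_one_of_mem_unitCube {u : Heis} (hu : u ∈ unitCube) : ‖u‖ ≤ 1 := by
  obtain ⟨ha, hb, hc⟩ := hu
  exact Heis.norm_le_iff.2 ⟨abs_le.2 ⟨by linarith [ha.1], ha.2⟩,
    abs_le.2 ⟨by linarith [hb.1], hb.2⟩, abs_le.2 ⟨by linarith [hc.1], hc.2⟩⟩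

theorem isCompact_unitCube : IsCompact unitCube :=
  Heis.entries.isCompact_preimage.2 (isCompact_Icc.prod (isCompact_Icc.prod isCompact_Icc))

theorem Nil.exists_mk_mul_eq (y : Nil) (w : Heis) : ∃ u ∈ unitCube, Nil.mk (u * w) = y := by
  obtain ⟨g, rfl⟩ := Quotient.exists_rep y
  obtain ⟨γ, hγ, ha, hb, hc⟩ := exists_gam_mul_mem_Ico (g * w⁻¹)
  refine ⟨γ * (g * w⁻¹), ⟨Ico_subset_Icc_self ha, Ico_subset_Icc_self hb, Ico_subset_Icc_self hc⟩,
    (Nil.mk_eq_mk_iff _ _).2 ?_⟩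
  simpa [mul_assoc] using Gam.inv_mem hγ

theorem Phase.exists_mk_mul_eq (p : Phase) (W : UnitAddCircle → Heis) :
    ∃ t ∈ Icc (0 : ℝ) 1, ∃ u ∈ unitCube, Phase.mk t (u * W t) = p := by
  obtain ⟨t, ht, hx⟩ : p.1 ∈ ((↑) : ℝ → UnitAddCircle) '' Icc 0 (0 + 1) := by
    rw [AddCircle.coe_image_Icc_eq]
    exact mem_univ _
  rw [zero_add] at ht
  obtain ⟨u, hu, hy⟩ := Nil.exists_mk_mul_eq p.2 (W t)
  exact ⟨t, ht, u, hu, Prod.ext hx hy⟩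

theorem exists_fin_abs_sub_div_le {N : ℕ} (hN : 0 < N) {t : ℝ} (ht : t ∈ Icc (0 : ℝ) 1) :
    ∃ i : Fin (N + 1), |t - i / N| ≤ 1 / N := by
  have hN' : (0 : ℝ) < N := by exact_mod_cast hN
  have h0 : 0 ≤ t * N := mul_nonneg ht.1 hN'.le
  have hi : ⌊t * N⌋₊ < N + 1 := Nat.lt_succ_of_le <| Nat.floor_le_of_le <|
    mul_le_of_le_one_left hN'.le ht.2
  refine ⟨⟨⌊t * N⌋₊, hi⟩, ?_⟩
  rw [show t - (⌊t * N⌋₊ : ℝ) / N = (t * N - ⌊t * N⌋₊) / N by field_simp, abs_div,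
    abs_of_pos hN', abs_of_nonneg (sub_nonneg.2 (Nat.floor_le h0))]
  gcongr
  linarith [Nat.lt_floor_add_one (t * N)]

/-- The shadowing orbits start at the grid points of the coordinates
`(t, u) ↦ Phase.mk t (u * W t)`. -/
theorem IsApproxConj.exists_shadowing {θ : UnitAddCircle} {M W : UnitAddCircle → Heis} {z : Heis}
    {L e : ℝ} (hW : IsApproxConj θ M W z L e) (hL : 1 ≤ L) {n N : ℕ} (hLN : 66 * L ≤ N)
    (hn : n * e ≤ 1 / N) :
    ∃ c : Fin (N + 1) × Fin (N + 1) × Fin (N + 1) × Fin (N + 1) → Phase, ∀ p, ∃ i, ∀ j < n,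
      Close (74 * L ^ 2 / N) ((skewProd θ M)^[j] (c i)) ((skewProd θ M)^[j] p) := by
  have hN : (0 : ℝ) < N := by linarith
  have hN0 : 0 < N := by exact_mod_cast hN
  have he : 0 ≤ e := (Heis.norm_nonneg _).trans (hW.error 0)
  let grid : Fin (N + 1) × Fin (N + 1) × Fin (N + 1) → Heis :=
    fun i => ⟨i.1 / N, i.2.1 / N, i.2.2 / N⟩
  let base : Fin (N + 1) → UnitAddCircle := fun i => ((i / N : ℝ) : UnitAddCircle)
  refine ⟨fun i => Phase.mk (base i.1) (grid i.2 * W (base i.1)), fun p => ?_⟩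
  obtain ⟨t, ht, u, hu, rfl⟩ := Phase.exists_mk_mul_eq p W
  obtain ⟨i, hi⟩ := exists_fin_abs_sub_div_le hN0 ht
  obtain ⟨ia, hia⟩ := exists_fin_abs_sub_div_le hN0 hu.1
  obtain ⟨ib, hib⟩ := exists_fin_abs_sub_div_le hN0 hu.2.1
  obtain ⟨ic, hic⟩ := exists_fin_abs_sub_div_le hN0 hu.2.2
  refine ⟨⟨i, ia, ib, ic⟩, fun j hj => ?_⟩
  have hbase : ‖base i - t‖ ≤ 2 * (1 / N) := by
    rw [norm_sub_rev]
    have hround : ‖((t - i / N : ℝ) : UnitAddCircle)‖ ≤ 1 / N :=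
      QuotientAddGroup.norm_mk_le_norm.trans hi
    exact hround.trans (by linarith [one_div_pos.2 hN])
  have hfibre : ‖u⁻¹ * grid (ia, ib, ic)‖ ≤ 2 * (1 / N) :=
    calc ‖u⁻¹ * grid (ia, ib, ic)‖
        ≤ (1 + ‖u‖) * ‖(grid (ia, ib, ic)).entries - u.entries‖ := Heis.norm_inv_mul_le _ _
      _ ≤ (1 + 1) * (1 / N) := by
          gcongr
          · exact norm_le_one_of_mem_unitCube hu
          · rw [norm_sub_rev]
            exact Heis.norm_entries_sub_le_iff.2 ⟨hia, hib, hic⟩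
      _ = 2 * (1 / N) := by norm_num
  have hscale : 33 * L * (2 * (1 / N)) ≤ 1 := by
    rw [← mul_assoc, mul_one_div, div_le_one hN]
    linarith
  have hj' : 2 * (j * e) ≤ 2 * (1 / N) := by
    gcongr
    exact (mul_le_mul_of_nonneg_right (by exact_mod_cast hj.le) he).trans hn
  convert hW.close_iterate hL hscale hj' hbase hfibre using 1
  ring

theorem natCast_pow_div_rpow_le_inv {q k b : ℕ} {τ : ℝ} (hq : 0 < q) (h : (k : ℝ) + 1 ≤ b * τ) :
    ((q ^ k : ℕ) : ENNReal) / ((q ^ b : ℕ) : ENNReal) ^ τ ≤ (q : ENNReal)⁻¹ := by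
  have hq0 : (q : ENNReal) ≠ 0 := by exact_mod_cast hq.ne'
  have hq1 : (1 : ENNReal) ≤ q := by exact_mod_cast hq
  rw [Nat.cast_pow, Nat.cast_pow, ← ENNReal.rpow_natCast, ← ENNReal.rpow_natCast,
    ← ENNReal.rpow_mul, ← ENNReal.rpow_sub _ _ hq0 (ENNReal.natCast_ne_top q),
    ← ENNReal.rpow_neg_one]
  exact ENNReal.rpow_le_rpow_of_exponent_le hq1 (by linarith)

section Complexity

variable {X : Type*} {T : X → X} {d : X → X → ℝ} {n : ℕ}

theorem meanDist_le {x y : X} {r : ℝ} (hr : 0 ≤ r) (h : ∀ j < n, d (T^[j] x) (T^[j] y) ≤ r) :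
    meanDist T d n x y ≤ r := by
  have hsum : ∑ j ∈ Finset.range n, d (T^[j] x) (T^[j] y) ≤ r * n :=
    (Finset.sum_le_sum fun j hj => h j (Finset.mem_range.1 hj)).trans_eq (by simp [mul_comm])
  rw [meanDist, one_div_mul_eq_div]
  exact div_le_of_le_mul₀ n.cast_nonneg hr hsum

variable [MeasurableSpace X] {ν : Measure X}

theorem coverNum_le_card [IsProbabilityMeasure ν] {ι : Type*} [Fintype ι] {ε : ℝ} (hε : 0 < ε)
    (c : ι → X) (h : ∀ y, ∃ i, meanDist T d n (c i) y < ε) :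
    coverNum T d ν n ε ≤ Fintype.card ι := by
  refine sInf_le ⟨_, c ∘ (Fintype.equivFin ι).symm, rfl, ?_⟩
  have hcover : ⋃ j, {y | meanDist T d n ((c ∘ (Fintype.equivFin ι).symm) j) y < ε} = univ := by
    refine eq_univ_of_forall fun y => ?_
    obtain ⟨i, hi⟩ := h y
    exact mem_iUnion.2 ⟨Fintype.equivFin ι i, by simpa using hi⟩
  rw [hcover, probReal_univ]
  linarith

/-- The exponent `k` must not depend on the exponent `b` of the orbit length. -/
theorem subPolynomial_of_frequently_coverNum_le
    (h : ∀ ε > 0, ∃ k : ℕ, ∀ b : ℕ, ∃ᶠ q : ℕ in atTop,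
      coverNum T d ν (q ^ b) ε ≤ (q ^ k : ℕ)) :
    SubPolynomial T d ν := by
  intro τ hτ ε hε
  obtain ⟨k, hk⟩ := h ε hε
  obtain ⟨b, hb⟩ := exists_nat_gt (((k : ℝ) + 1) / τ)
  have hb0 : b ≠ 0 := by
    have : (0 : ℝ) < b := lt_trans (by positivity) hb
    exact_mod_cast this.ne'
  rw [div_lt_iff₀ hτ] at hb
  refine nonpos_iff_eq_zero.1 (ENNReal.le_of_forall_pos_le_add fun c hc _ => ?_)
  rw [zero_add]
  refine liminf_le_of_frequently_le' ((tendsto_pow_atTop hb0).frequently ?_)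
  have hinv : ∀ᶠ q : ℕ in atTop, (q : ENNReal)⁻¹ < c :=
    ENNReal.tendsto_inv_nat_nhds_zero.eventually_lt_const (by exact_mod_cast hc)
  refine ((hk b).and_eventually (hinv.and (eventually_gt_atTop 0))).mono ?_
  rintro q ⟨hcov, hqc, hq⟩
  calc ((coverNum T d ν (q ^ b) ε : ℕ∞) : ENNReal) / ((q ^ b : ℕ) : ENNReal) ^ τ
      ≤ ((q ^ k : ℕ) : ENNReal) / ((q ^ b : ℕ) : ENNReal) ^ τ := by
        gcongr
        exact_mod_cast ENat.toENNReal_le.2 hcov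
    _ ≤ (q : ENNReal)⁻¹ := natCast_pow_div_rpow_le_inv hq hb.le
    _ ≤ c := hqc.le

end Complexity

/-- The bound does not depend on `b`: the grid of mesh `1 / q ^ (2 * k + 2)` serves all orbit
lengths because the error of the conjugation is small compared with the length. -/
theorem coverNum_skewProd_le {θ : UnitAddCircle} {M W : UnitAddCircle → Heis} {z : Heis}
    {ρ : Measure Phase} [IsProbabilityMeasure ρ] {d : Phase → Phase → ℝ} {k b q : ℕ} {δ ε : ℝ}
    (hε : 0 < ε) (hd : ∀ p p', Close δ p p' → d p p' ≤ ε / 2)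
    (hW : IsApproxConj θ M W z (q ^ k) (1 / q ^ (b + (2 * k + 2)))) (hq : 66 ≤ q)
    (hqδ : 74 / (q : ℝ) ^ 2 ≤ δ) :
    coverNum (skewProd θ M) d ρ (q ^ b) ε ≤ (q ^ (8 * k + 12) : ℕ) := by
  have hq66 : (66 : ℝ) ≤ q := by exact_mod_cast hq
  have hq1 : (1 : ℝ) ≤ q := by linarith
  have hqpow : (q : ℝ) ^ k ≤ q ^ (2 * k + 1) := pow_le_pow_right₀ hq1 (by omega)
  obtain ⟨c, hc⟩ := hW.exists_shadowing (n := q ^ b) (N := q ^ (2 * k + 2)) (one_le_pow₀ hq1)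
    (by
      push_cast
      calc 66 * (q : ℝ) ^ k ≤ q * q ^ (2 * k + 1) := by gcongr
        _ = q ^ (2 * k + 2) := by ring)
    (by
      push_cast
      rw [pow_add, mul_one_div, div_mul_cancel_left₀ (by positivity), one_div])
  have hscale : 74 * ((q : ℝ) ^ k) ^ 2 / (q ^ (2 * k + 2) : ℕ) ≤ δ := by
    refine le_of_eq_of_le ?_ hqδ
    push_cast
    field_simp
    ring
  refine (coverNum_le_card hε c fun p => ?_).trans ?_
  · obtain ⟨i, hi⟩ := hc p
    exact ⟨i, (meanDist_le (half_pos hε).le fun j hj => hd _ _ ((hi j hj).mono hscale)).trans_lt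
      (half_lt_self hε)⟩
  · have hcard : q ^ (2 * k + 2) + 1 ≤ q ^ (2 * k + 3) := by
      rw [pow_succ _ (2 * k + 2)]
      nlinarith [Nat.one_le_pow (2 * k + 2) q (by omega)]
    simp only [Fintype.card_prod, Fintype.card_fin, Nat.cast_le]
    calc _ = (q ^ (2 * k + 2) + 1) ^ 4 := by ring
      _ ≤ (q ^ (2 * k + 3)) ^ 4 := Nat.pow_le_pow_left hcard 4
      _ = q ^ (8 * k + 12) := by ring

theorem subPolynomial_skewProd {θ : UnitAddCircle} {M : UnitAddCircle → Heis} {ρ : Measure Phase}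
    [IsProbabilityMeasure ρ] {d : Phase → Phase → ℝ} {k : ℕ}
    (hM : ∀ B : ℕ, ∃ᶠ q : ℕ in atTop, ∃ W z, IsApproxConj θ M W z (q ^ k) (1 / q ^ B))
    (hd : ∀ ε > 0, ∃ δ > 0, ∀ p p', Close δ p p' → d p p' ≤ ε) :
    SubPolynomial (skewProd θ M) d ρ := by
  refine subPolynomial_of_frequently_coverNum_le fun ε hε => ⟨8 * k + 12, fun b => ?_⟩
  obtain ⟨δ, hδ, hclose⟩ := hd (ε / 2) (half_pos hε)
  have hlim : Tendsto (fun q : ℕ => 74 / (q : ℝ) ^ 2) atTop (𝓝 0) :=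
    ((tendsto_pow_atTop two_ne_zero).comp tendsto_natCast_atTop_atTop).const_div_atTop 74
  refine ((hM (b + (2 * k + 2))).and_eventually
    ((hlim.eventually_le_const hδ).and (eventually_ge_atTop 66))).mono ?_
  rintro q ⟨⟨W, z, hW⟩, hqδ, hq⟩
  exact coverNum_skewProd_le hε hclose hW hq hqδ

theorem pdist_le_of_close {δ : Heis → Heis → ℝ} (hδ : ∀ g h, 0 ≤ δ g h)
    (hkap : ∀ g h, δ g h ≤ kap (g⁻¹ * h)) {r : ℝ} {p q : Phase} (hpq : Close r p q) :
    pdist δ p q ≤ 2 * r := by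
  obtain ⟨hx, g, h, hg, hh, hgh⟩ := hpq
  have hnonneg : ∀ s ∈ {s | ∃ g h, Nil.mk g = p.2 ∧ Nil.mk h = q.2 ∧ s = δ g h}, 0 ≤ s := by
    rintro s ⟨g, h, -, -, rfl⟩
    exact hδ g h
  have hndist : Nil.ndist δ p.2 q.2 ≤ r := by
    refine (csInf_le ⟨0, hnonneg⟩ ⟨g, h, hg, hh, rfl⟩).trans ((hkap g h).trans ?_)
    rwa [Heis.kap_eq_norm_inv, mul_inv_rev, inv_inv]
  have hndist0 : 0 ≤ Nil.ndist δ p.2 q.2 := Real.sInf_nonneg hnonneg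
  have hr : 0 ≤ r := hndist0.trans hndist
  refine Real.sqrt_le_iff.2 ⟨by positivity, ?_⟩
  calc ‖p.1 - q.1‖ ^ 2 + Nil.ndist δ p.2 q.2 ^ 2 ≤ r ^ 2 + r ^ 2 := by gcongr
    _ ≤ (2 * r) ^ 2 := by nlinarith

theorem Heis.hasBasis_nhds_one :
    (𝓝 (1 : Heis)).HasBasis (fun r : ℝ => 0 < r) fun r => {g | ‖g‖ ≤ r} := by
  rw [Heis.entries.isInducing.nhds_eq_comap]
  convert Metric.nhds_basis_closedBall.comap Heis.entries using 2 with r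
  ext g
  exact (mem_closedBall_zero_iff (a := Heis.entries g)).symm

instance : ContinuousMul Heis := by
  refine ⟨Heis.entries.comp_continuous_iff.1 ?_⟩
  have ha : Continuous Heis.a := continuous_fst.comp Heis.entries.continuous
  have hb : Continuous Heis.b := (continuous_fst.comp continuous_snd).comp Heis.entries.continuous
  have hc : Continuous Heis.c := (continuous_snd.comp continuous_snd).comp Heis.entries.continuous
  change Continuous fun x : Heis × Heis =>
    (x.1.a + x.2.a, x.1.b + x.2.b, x.1.c + x.2.c + x.1.a * x.2.b)
  fun_prop

theorem Phase.continuous_mk : Continuous fun x : UnitAddCircle × Heis => Phase.mk x.1 x.2 :=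
  continuous_id.prodMap continuous_quotient_mk'

/-- Neighbouring points are translates of points of a compact set of representatives by a small
element. -/
theorem exists_le_of_close {d : Phase → Phase → ℝ}
    (hd : Continuous fun x : Phase × Phase => d x.1 x.2) (hd0 : ∀ p, d p p = 0) {ε : ℝ}
    (hε : 0 < ε) : ∃ δ > 0, ∀ p q, Close δ p q → d p q ≤ ε := by
  let D : (UnitAddCircle × Heis) × UnitAddCircle × Heis → ℝ := fun s =>
    d (Phase.mk (s.2.1 + s.1.1) (s.2.2 * s.1.2)) (Phase.mk s.2.1 s.2.2)
  have hD : Continuous D :=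
    hd.comp ((Phase.continuous_mk.comp
      (f := fun s : (UnitAddCircle × Heis) × UnitAddCircle × Heis =>
        (s.2.1 + s.1.1, s.2.2 * s.1.2)) (by fun_prop)).prodMk
      (Phase.continuous_mk.comp continuous_snd))
  have hnhds : ∀ᶠ v in 𝓝 ((0, 1) : UnitAddCircle × Heis), ∀ y ∈ univ ×ˢ unitCube, D (v, y) < ε :=
    (isCompact_univ.prod isCompact_unitCube).eventually_forall_of_forall_eventually
      fun y _ => hD.continuousAt.eventually_lt continuousAt_const (by simpa [D, hd0] using hε)
  obtain ⟨⟨r, s⟩, ⟨hr, hs⟩, hball⟩ :=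
    (Metric.nhds_basis_closedBall.prod_nhds Heis.hasBasis_nhds_one).eventually_iff.1 hnhds
  refine ⟨min r s, lt_min hr hs, ?_⟩
  rintro ⟨x, -⟩ ⟨y, -⟩ ⟨hxy, g, h, rfl, rfl, hgh⟩
  obtain ⟨u, hu, hh⟩ := Nil.exists_mk_mul_eq (Nil.mk h) 1
  rw [mul_one] at hh
  have hg : Nil.mk (u * (h⁻¹ * g)) = Nil.mk g := by
    rw [← Nil.rmul_mk, hh, Nil.rmul_mk, mul_inv_cancel_left]
  have hsmall := hball (x := (x - y, h⁻¹ * g))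
    ⟨mem_closedBall_zero_iff.2 (hxy.trans (min_le_left _ _)), hgh.trans (min_le_right _ _)⟩
    (y, u) ⟨mem_univ _, hu⟩
  simp only [D, Phase.mk, add_sub_cancel, hg, hh] at hsmall
  exact hsmall.le

theorem frequently_exists_isApproxConj {α : ℝ} (hα : Irrational α) {f g h : UnitAddCircle → ℝ}
    (hf : ContDiff ℝ ∞ fun t : ℝ => f t) (hg : ContDiff ℝ ∞ fun t : ℝ => g t)
    (hh : ContDiff ℝ ∞ fun t : ℝ => h t) (hf0 : ∫ x, f x = 0) (hg0 : ∫ x, g x = 0) (B : ℕ) :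
    ∃ᶠ q : ℕ in atTop, ∃ W z, IsApproxConj (α : UnitAddCircle) (fun x => ⟨f x, g x, h x⟩) W z
      (q ^ 7) (1 / q ^ B) :=
  ((frequently_hasSmallDivisorBound hα).and_eventually
    (eventually_exists_isApproxConj α hf hg hh hf0 hg0 B)).mono fun _ hq => hq.2 hq.1

theorem continuous_dist_of_induces {X : Type*} [TopologicalSpace X] {m : MetricSpace X}
    (hm : Induces m) : Continuous fun p : X × X => m.dist p.1 p.2 := by
  unfold Induces at hm
  subst hm
  exact continuous_dist

theorem integral_lift_eq {f : ℝ → ℝ} (hf : Function.Periodic f 1) :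
    ∫ x : UnitAddCircle, hf.lift x = ∫ t in (0 : ℝ)..1, f t := by
  simpa using (UnitAddCircle.intervalIntegral_preimage 0 hf.lift).symm

theorem skew_eq_skewProd (α : ℝ) {φ η ψ : ℝ → ℝ} (hφ : Function.Periodic φ 1)
    (hη : Function.Periodic η 1) (hψ : Function.Periodic ψ 1) :
    skew α hφ hη hψ = skewProd α fun x => ⟨hφ.lift x, hη.lift x, hψ.lift x⟩ := rfl

end HeisSkew

theorem theorem1p3_general {α : ℝ} (hα : Irrational α) {φ η ψ : ℝ → ℝ}
    (hφ : Function.Periodic φ 1) (hη : Function.Periodic η 1) (hψ : Function.Periodic ψ 1)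
    (hφs : ContDiff ℝ ∞ φ) (hηs : ContDiff ℝ ∞ η) (hψs : ContDiff ℝ ∞ ψ)
    (hφ0 : ∫ t in (0 : ℝ)..1, φ t = 0) (hη0 : ∫ t in (0 : ℝ)..1, η t = 0)
    (ρ : Measure HeisSkew.Phase) [IsProbabilityMeasure ρ] :
    (∀ δ : HeisSkew.Heis → HeisSkew.Heis → ℝ, (∀ g h, 0 ≤ δ g h) →
      (∀ g h, δ g h ≤ HeisSkew.kap (g⁻¹ * h)) →
      HeisSkew.SubPolynomial (HeisSkew.skew α hφ hη hψ) (HeisSkew.pdist δ) ρ) ∧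
    (∀ d : HeisSkew.Phase → HeisSkew.Phase → ℝ,
      Continuous (fun p : HeisSkew.Phase × HeisSkew.Phase => d p.1 p.2) → (∀ p, d p p = 0) →
      HeisSkew.SubPolynomial (HeisSkew.skew α hφ hη hψ) d ρ) := by
  rw [HeisSkew.skew_eq_skewProd]
  have hM := HeisSkew.frequently_exists_isApproxConj hα (f := hφ.lift) (g := hη.lift)
    (h := hψ.lift) hφs hηs hψs (by rwa [HeisSkew.integral_lift_eq])
    (by rwa [HeisSkew.integral_lift_eq])
  refine ⟨fun δ hδ hkap => HeisSkew.subPolynomial_skewProd hM fun ε hε => ?_,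
    fun d hd hd0 => HeisSkew.subPolynomial_skewProd hM fun ε hε => ?_⟩
  · refine ⟨ε / 2, half_pos hε, fun p q hpq => ?_⟩
    exact (HeisSkew.pdist_le_of_close hδ hkap hpq).trans_eq (by ring)
  · exact HeisSkew.exists_le_of_close hd hd0 hε

end

theorem theorem1p3 (α : ℝ) (hα : Irrational α) (φ η ψ : ℝ → ℝ)
    (hφ : Function.Periodic φ 1) (hη : Function.Periodic η 1) (hψ : Function.Periodic ψ 1)
    (hφs : ContDiff ℝ ∞ φ) (hηs : ContDiff ℝ ∞ η) (hψs : ContDiff ℝ ∞ ψ)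
    (hφ0 : ∫ t in (0 : ℝ)..1, φ t = 0) (hη0 : ∫ t in (0 : ℝ)..1, η t = 0)
    (ρ : MeasureTheory.Measure HeisSkew.Phase) (hρ : MeasureTheory.IsProbabilityMeasure ρ)
    (hinv : MeasureTheory.MeasurePreserving (HeisSkew.skew α hφ hη hψ) ρ ρ) :
    -- for the metric that comes from a left invariant metric on the Heisenberg group
    (∀ mG : MetricSpace HeisSkew.Heis,
      (∀ k g h : HeisSkew.Heis, mG.dist (k * g) (k * h) = mG.dist g h) →
      (∀ g h : HeisSkew.Heis, mG.dist g h ≤ HeisSkew.kap (g⁻¹ * h)) →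
      HeisSkew.SubPolynomial (HeisSkew.skew α hφ hη hψ) (HeisSkew.pdist mG.dist) ρ) ∧
    -- and for every metric that induces the topology
    (∀ m : MetricSpace HeisSkew.Phase, HeisSkew.Induces m →
      HeisSkew.SubPolynomial (HeisSkew.skew α hφ hη hψ) m.dist ρ) := by
  have : MeasureTheory.IsProbabilityMeasure ρ := hρ
  obtain ⟨h₁, h₂⟩ := theorem1p3_general hα hφ hη hψ hφs hηs hψs hφ0 hη0 ρ
  exact ⟨fun mG _ hk => h₁ mG.dist (fun _ _ => dist_nonneg) hk,
    fun m hm => h₂ m.dist (HeisSkew.continuous_dist_of_induces hm) dist_self⟩
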